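/- There are absolute constants $c'>0$ and $C>0$ such that the following holds. Let $A\in\mathbb R^{n\times n}$ be symmetric, $h\in\mathbb R^n$, and let $\pi(x)\propto\exp(\tfrac12x^{T}Ax+h^{T}x)$ be the corresponding Ising model on $\{-1,1\}^n$. Write $x^{i\mapsto\sigma}$ for $x$ with its $i$th coordinate set to $\sigma$, and $x^{\oplus i}$ for $x$ with its $i$th coordinate negated. Suppose that for some $d\in\mathbb N$, $d>0$, and reals $\lambda,\alpha_0>0$: every row $i$ of $A$ has at most $d$ nonzero entries $A_{ik}$ with $k\ne i$; $\sum_{k\neq i}|A_{ik}|+|h_i|\le\lambda$ for every $i$; and $|A_{ij}|\ge\alpha_0$ whenever $i\ne j$ and $A_{ij}\neq0$. Let $\mathsf P_1,\dots,\mathsf P_n$ be Markov kernels on $\{-1,1\}^n$ such that $\mathsf P_i(x,\cdot)$ is supported on $\{x,x^{\oplus i}\}$ and $\pi(x)\mathsf P_i(x,x^{\oplus i})=\pi(x^{\oplus i})\mathsf P_i(x^{\oplus i},x)$ for all $i$ and $x$. Suppose moreover: 1. (Site-consistency) For each $i$ there is a nondecreasing $f_i:(0,\infty)\to[0,1]$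 with $\mathsf P_i(x^{i\mapsto-1},x^{i\mapsto+1})=f_i\big(\pi(x^{i\mapsto+1})/\pi(x^{i\mapsto-1})\big)$ for all $x$. 2. (Stability) $\alpha_0\le\lambda$, and there are $\delta_0>0$ and a nondecreasing $\eta:[0,1]\to[0,\infty)$ with $\eta(0)=0$ such that, with $g_i(z)=f_i(z)^2/z$, for all $i$ and all $a\ge\alpha_0$ there is a unique $z^*>0$ with $g_i(z^*)=g_i(e^{a}z^*)$, and for all $\delta\in[0,1]$ with $\delta\le\delta_0$ and all $z\in[e^{-2\lambda},e^{2\lambda}]$, $|g_i(z)-g_i(e^{a}z)|\le\delta$ implies $|z^*-z|\le\eta(\delta)$. 3. (Boundedness) $\gamma\ge0$, and for all $i$, all $\sigma\in\{\pm1\}$ and all $x,y$ with $x_i=y_i$, $\ \mathsf P_i(x,x^{i\mapsto\sigma})\le\exp\big(\gamma\sum_{k:\,x_k\ne y_k}|A_{ik}|\big)\,\mathsf P_i(y,y^{i\mapsto\sigma})$. 4. $\kappa>0$ and $\mathsf P_i(x,x^{\oplus i})\ge\kappa$ for all $i$ and $x$. Let $\mathcal D$ be any probability distribution on $\{-1,1\}^n$,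 and let $(X^t)_{t\ge0}$ be the continuous-time Markov chain with generator $\mathcal L=\sum_{i=1}^n(\mathsf P_i-I)$ (each site has an independent rate-$1$ Poisson clock, at whose rings $\mathsf P_i$ is applied), that is, with transition matrices $H_t=\exp(t\mathcal L)$, and with $X^0\sim\mathcal D$. Let $\alpha>0$, let $\ell(x)=\sum_{k=1}^n v_kx_k$ be a linear form with real coefficients, and let $i$ be an index with $|v_i|\ge\alpha$. Then for every $c\in\mathbb R$ and every $t\ge1$, $$\Pr\big(|\ell(X^t)-c|\ge\alpha\big)\ \ge\ c'\exp(-C\gamma\lambda)\,\kappa^4 .$$ -/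

import Mathlib

open scoped NNReal

noncomputable section

namespace SpinChain

/-- Spin configurations `{-1, 1}ⁿ`; the units of `ℤ` are exactly `1` and `-1`. -/
abbrev Config (n : ℕ) : Type := Fin n → ℤˣ

/-- The real vector with entries `±1` of a configuration. -/
def Config.toReal {n : ℕ} (x : Config n) : Fin n → ℝ := fun i => ((x i : ℤ) : ℝ)

/-- The configuration `x` with the value at site `i` reset to `σ`. -/
def Config.set {n : ℕ} (x : Config n) (i : Fin n) (σ : ℤˣ) : Config n := Function.update x i σ

/-- The configuration `x` with the value at site `i` negated. -/
def Config.flip {n : ℕ} (x : Config n) (i : Fin n) : Config n := x.set i (-x i)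

/-! ### Ising models -/

/-- The unnormalized Ising weight `exp (xᵀ A x / 2 + hᵀ x)`. -/
def isingWeight {n : ℕ} (A : Matrix (Fin n) (Fin n) ℝ) (h : Fin n → ℝ) (x : Config n) : ℝ :=
  Real.exp ((1 / 2) * (x.toReal ⬝ᵥ A.mulVec x.toReal) + h ⬝ᵥ x.toReal)

/-- The Ising model `π_{A,h}`, as a probability mass function. -/
def ising {n : ℕ} (A : Matrix (Fin n) (Fin n) ℝ) (h : Fin n → ℝ) (x : Config n) : ℝ :=
  isingWeight A h x / ∑ y : Config n, isingWeight A h y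

/-- The assumptions on the Ising model: `A` is symmetric, every site has at most `d` neighbours,
the width is at most `lam`, and the nonzero interactions have size at least `α₀`. -/
structure IsingAssumption {n : ℕ} (A : Matrix (Fin n) (Fin n) ℝ) (h : Fin n → ℝ)
    (d : ℕ) (lam α₀ : ℝ) : Prop where
  d_pos : 0 < d
  lam_pos : 0 < lam
  alpha_pos : 0 < α₀
  symm : A.IsSymm
  degree : ∀ i, (Finset.univ.filter fun k => k ≠ i ∧ A i k ≠ 0).card ≤ d
  width : ∀ i, (∑ k ∈ Finset.univ.erase i, |A i k|) + |h i| ≤ lam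
  nondegenerate : ∀ i j, i ≠ j → A i j ≠ 0 → α₀ ≤ |A i j|

/-! ### Single-site chains -/

/-- `P i` is the transition kernel applied when the clock of site `i` rings: a stochastic matrix
that changes no other site than `i`. -/
structure IsSingleSite {n : ℕ} (P : Fin n → Matrix (Config n) (Config n) ℝ) : Prop where
  nonneg : ∀ i x y, 0 ≤ P i x y
  row_sum : ∀ i x, ∑ y, P i x y = 1
  single : ∀ (i : Fin n) (x y : Config n), y ≠ x → y ≠ x.flip i → P i x y = 0

/-- Detailed balance with respect to the mass function `π`. -/
def IsReversible {n : ℕ} (π : Config n → ℝ) (P : Fin n → Matrix (Config n) (Config n) ℝ) : Prop :=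
  ∀ (i : Fin n) (x : Config n), π x * P i x (x.flip i) = P i (x.flip i) x * π (x.flip i)

/-- Site-consistency, with `f i : (0, ∞) → [0, 1]` nondecreasing as the witnessing functions. -/
structure IsSiteConsistent {n : ℕ} (π : Config n → ℝ)
    (P : Fin n → Matrix (Config n) (Config n) ℝ) (f : Fin n → ℝ → ℝ) : Prop where
  mono : ∀ i, MonotoneOn (f i) (Set.Ioi 0)
  mem_Icc : ∀ i, ∀ z > 0, f i z ∈ Set.Icc (0 : ℝ) 1
  up : ∀ (i : Fin n) (x : Config n),
    P i (x.set i (-1)) (x.set i 1) = f i (π (x.set i 1) / π (x.set i (-1)))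

/-- Stability of the transitions, for the functions `g i z = (f i z)² / z`.
The function `η` matters only on `[0, 1]`. -/
structure IsStable {n : ℕ} (f : Fin n → ℝ → ℝ) (lam α₀ δ₀ : ℝ) (η : ℝ → ℝ) : Prop where
  alpha_pos : 0 < α₀
  alpha_le : α₀ ≤ lam
  delta_pos : 0 < δ₀
  eta_nonneg : ∀ δ ∈ Set.Icc (0 : ℝ) 1, 0 ≤ η δ
  eta_mono : MonotoneOn η (Set.Icc 0 1)
  eta_zero : η 0 = 0
  stable : ∀ i, ∀ a ≥ α₀, ∃ zs > 0,
    f i zs ^ 2 / zs = f i (Real.exp a * zs) ^ 2 / (Real.exp a * zs) ∧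
    (∀ z > 0, f i z ^ 2 / z = f i (Real.exp a * z) ^ 2 / (Real.exp a * z) → z = zs) ∧
    ∀ δ ∈ Set.Icc (0 : ℝ) 1, δ ≤ δ₀ →
      ∀ z ∈ Set.Icc (Real.exp (-2 * lam)) (Real.exp (2 * lam)),
        |f i z ^ 2 / z - f i (Real.exp a * z) ^ 2 / (Real.exp a * z)| ≤ δ → |zs - z| ≤ η δ

/-- `γ`-boundedness. The bound on the ratio of `P i x (x.set i σ)` to `P i y (y.set i σ)` is
multiplied out, because holding probabilities (`σ = x i = y i`) may vanish. -/
def IsBounded {n : ℕ} (A : Matrix (Fin n) (Fin n) ℝ)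
    (P : Fin n → Matrix (Config n) (Config n) ℝ) (γ : ℝ) : Prop :=
  ∀ (i : Fin n) (x y : Config n), x i = y i → ∀ σ : ℤˣ,
    P i x (x.set i σ) ≤
      Real.exp (γ * ∑ k ∈ Finset.univ.filter (fun k => x k ≠ y k), |A i k|) * P i y (y.set i σ)

/-- The assumptions on the single-site chain. That every site is updated at rate one is part of
the definition of the generator below. -/
structure ChainAssumption {n : ℕ} (A : Matrix (Fin n) (Fin n) ℝ) (h : Fin n → ℝ)
    (P : Fin n → Matrix (Config n) (Config n) ℝ)
    (lam α₀ δ₀ : ℝ) (η : ℝ → ℝ) (γ κ : ℝ) : Prop where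
  single_site : IsSingleSite P
  reversible : IsReversible (ising A h) P
  consistent_stable : ∃ f : Fin n → ℝ → ℝ,
    IsSiteConsistent (ising A h) P f ∧ IsStable f lam α₀ δ₀ η
  gamma_nonneg : 0 ≤ γ
  bounded : IsBounded A P γ
  kappa_pos : 0 < κ
  flip_ge : ∀ (i : Fin n) (x : Config n), κ ≤ P i x (x.flip i)

/-! ### The continuous-time chain -/

/-- The generator `∑ᵢ (Pᵢ - I)`: each site carries an independent Poisson clock of rate one. -/
def generator {n : ℕ} (P : Fin n → Matrix (Config n) (Config n) ℝ) :
    Matrix (Config n) (Config n) ℝ :=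
  ∑ i, (P i - 1)

/-- The transition matrix `H_t = exp (t L)`. -/
def transition {n : ℕ} (P : Fin n → Matrix (Config n) (Config n) ℝ) (t : ℝ) :
    Matrix (Config n) (Config n) ℝ :=
  NormedSpace.exp (t • generator P)

/-- `X` is a continuous-time Markov chain with initial distribution `D` and transition matrices
`H_t`: for all times `0 = s₀ ≤ s₁ ≤ … ≤ s_m` and all configurations `x₀, …, x_m`,
`Pr (X_{s₀} = x₀, …, X_{s_m} = x_m) = D(x₀) ∏ₖ H_{s_{k+1} - s_k}(x_k, x_{k+1})`. -/
structure IsChain {n : ℕ} (P : Fin n → Matrix (Config n) (Config n) ℝ) (D : PMF (Config n))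
    {Ω : Type*} [MeasurableSpace Ω] (ℙ : MeasureTheory.Measure Ω) (X : ℝ≥0 → Ω → Config n) :
    Prop where
  measurable : ∀ t x, MeasurableSet {ω | X t ω = x}
  fdd : ∀ (m : ℕ) (s : Fin (m + 1) → ℝ≥0), Monotone s → s 0 = 0 →
    ∀ x : Fin (m + 1) → Config n,
      ℙ.real {ω | ∀ k, X (s k) ω = x k} =
        (D (x 0)).toReal *
          ∏ k : Fin m, transition P ((s k.succ : ℝ) - s k.castSucc) (x k.castSucc) (x k.succ)

end SpinChain

end

/-! ### Entrywise comparison of exponentials of nonnegative matrices -/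

namespace Matrix

variable {X : Type*} [Fintype X] [DecidableEq X]

/-! Flipping spin `i` moves the linear form by `2|v i| ≥ 2α`, so of `y` and `y.flip i` at least one
lies in the good set `G`. Up to the factor `e^{-n}`, `transition P 1` is `exp (S + R)` with `R = P
i` and `S` the sum of the other kernels. Put `T = ∑ k ≠ i, e^{-γ|A i k|} P k`. By boundedness `T ≤
S` entrywise, both as it stands and conjugated by the flip `φ`. Hence `exp T ≤ exp (S + R)`, and
using `R` once for a flip gives `κ * exp T x (φ y) ≤ exp (S + R) x y`
(`mul_exp_apply_le_exp_add_apply`). So `G` receives at least `κ/2` of the row mass of `exp T`, which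
is at least `e^{n-1-γλ}`. The semigroup property carries the bound from time 1 to later times. -/

theorem hasSum_exp_apply (Q : Matrix X X ℝ) (x y : X) :
    HasSum (fun m : ℕ => ((m.factorial : ℝ))⁻¹ * (Q ^ m) x y) (NormedSpace.exp Q x y) := by
  let _ : NormedRing (Matrix X X ℝ) := Matrix.linftyOpNormedRing
  let _ : NormedAlgebra ℝ (Matrix X X ℝ) := Matrix.linftyOpNormedAlgebra
  let _ : NormedAlgebra ℚ (Matrix X X ℝ) := NormedAlgebra.restrictScalars ℚ ℝ _
  have h : HasSum (fun m : ℕ => ((m.factorial : ℝ))⁻¹ • Q ^ m) (NormedSpace.exp Q) :=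
    NormedSpace.exp_series_hasSum_exp' (𝕂 := ℝ) Q
  exact Pi.hasSum.1 (Pi.hasSum.1 h x) y

theorem exp_apply_nonneg {Q : Matrix X X ℝ} (hQ : ∀ x y, 0 ≤ Q x y) (x y : X) :
    0 ≤ NormedSpace.exp Q x y :=
  (hasSum_exp_apply Q x y).nonneg fun m =>
    mul_nonneg (by positivity) (pow_apply_nonneg hQ m x y)

theorem sum_pow_apply {Q : Matrix X X ℝ} {r : ℝ} (hQ : ∀ x, ∑ y, Q x y = r) (m : ℕ) (x : X) :
    ∑ y, (Q ^ m) x y = r ^ m := by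
  induction m generalizing x with
  | zero => simp [one_apply]
  | succ m ih =>
    simp_rw [pow_succ' Q, mul_apply]
    rw [Finset.sum_comm]
    simp_rw [← Finset.mul_sum, ih, ← Finset.sum_mul, hQ, pow_succ']

theorem sum_exp_apply {Q : Matrix X X ℝ} {r : ℝ} (hQ : ∀ x, ∑ y, Q x y = r) (x : X) :
    ∑ y, NormedSpace.exp Q x y = Real.exp r := by
  have h := hasSum_sum (s := Finset.univ) fun y _ => hasSum_exp_apply Q x y
  simp_rw [← Finset.mul_sum, sum_pow_apply hQ] at h
  refine h.unique ?_
  have h' := NormedSpace.exp_series_hasSum_exp' (𝕂 := ℝ) r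
  rw [← Real.exp_eq_exp_ℝ] at h'
  simpa only [smul_eq_mul] using h'

/-- Powers of an entrywise larger matrix are entrywise larger, also after relabelling the rows
and columns of the smaller one. -/
theorem pow_apply_le_pow_apply {T M : Matrix X X ℝ} (φ : X ≃ X) (hT : ∀ x y, 0 ≤ T x y)
    (hTM : ∀ x y, T (φ x) (φ y) ≤ M x y) (m : ℕ) (x y : X) :
    (T ^ m) (φ x) (φ y) ≤ (M ^ m) x y := by
  have hM : ∀ x y, 0 ≤ M x y := fun x y => (hT _ _).trans (hTM x y)
  induction m generalizing x y with
  | zero => simp [one_apply]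
  | succ m ih =>
    rw [pow_succ', pow_succ', mul_apply, mul_apply, ← φ.sum_comp]
    exact Finset.sum_le_sum fun z _ =>
      mul_le_mul (hTM x z) (ih z y) (pow_apply_nonneg hT m _ _) (hM x z)

/-- A word in `S + R` that uses the letter `R` once can be compared with a word in `T` followed by
the involution `φ`. -/
theorem mul_pow_apply_le_pow_succ_apply {S R T : Matrix X X ℝ} {φ : X ≃ X} {κ : ℝ}
    (hφ : ∀ x, φ (φ x) = x) (hT : ∀ x y, 0 ≤ T x y) (hR : ∀ x y, 0 ≤ R x y)
    (hTS : ∀ x y, T x y ≤ S x y) (hTS' : ∀ x y, T (φ x) (φ y) ≤ S x y)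
    (hκ : 0 ≤ κ) (hRκ : ∀ x, κ ≤ R x (φ x)) (m : ℕ) (x y : X) :
    κ * (m + 1) * (T ^ m) x (φ y) ≤ ((S + R) ^ (m + 1)) x y := by
  have hS : ∀ x y, 0 ≤ S x y := fun x y => (hT _ _).trans (hTS x y)
  have hM : ∀ x y, 0 ≤ (S + R) x y := fun x y => add_nonneg (hS x y) (hR x y)
  have hone (m : ℕ) (x y : X) : κ * (T ^ m) x (φ y) ≤ (R * (S + R) ^ m) x y := by
    rw [mul_apply]
    -- Keep only the path on which `R` flips; the later letters are then bounded below by the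
    -- conjugated `T`.
    refine le_trans ?_ (Finset.single_le_sum
      (f := fun z => R x z * ((S + R) ^ m) z y) (a := φ x)
      (fun z _ => mul_nonneg (hR x z) (pow_apply_nonneg hM m z y)) (Finset.mem_univ _))
    refine mul_le_mul (hRκ x) ?_ (pow_apply_nonneg hT m _ _) (hR _ _)
    have h := pow_apply_le_pow_apply (M := S + R) φ hT
      (fun a b => (hTS' a b).trans (le_add_of_nonneg_right (hR a b))) m (φ x) y
    rwa [hφ] at h
  induction m generalizing x y with
  | zero =>
    have h := hone 0 x y
    rw [pow_succ', add_mul, add_apply]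
    have h0 : 0 ≤ (S * (S + R) ^ 0) x y := by simpa using hS x y
    push_cast
    linarith
  | succ m ih =>
    -- Split by the first letter: `S` leaves `m + 1` places for the flip, `R` supplies the remaining
    -- one.
    rw [pow_succ' (S + R), add_mul, add_apply]
    have h1 : κ * (m + 1) * (T ^ (m + 1)) x (φ y) ≤ (S * (S + R) ^ (m + 1)) x y := by
      rw [pow_succ' T, mul_apply, mul_apply, Finset.mul_sum]
      refine Finset.sum_le_sum fun z _ => ?_
      calc κ * (m + 1) * (T x z * (T ^ m) z (φ y))
          = T x z * (κ * (m + 1) * (T ^ m) z (φ y)) := by ring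
        _ ≤ S x z * ((S + R) ^ (m + 1)) z y :=
          mul_le_mul (hTS x z) (ih z y)
            (mul_nonneg (by positivity) (pow_apply_nonneg hT m _ _)) (hS x z)
    have h2 := hone (m + 1) x y
    push_cast
    linarith

theorem exp_apply_le_exp_apply {T M : Matrix X X ℝ} (hT : ∀ x y, 0 ≤ T x y)
    (hTM : ∀ x y, T x y ≤ M x y) (x y : X) :
    NormedSpace.exp T x y ≤ NormedSpace.exp M x y :=
  hasSum_le (fun m => mul_le_mul_of_nonneg_left
    (pow_apply_le_pow_apply (Equiv.refl X) hT hTM m x y) (by positivity))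
    (hasSum_exp_apply T x y) (hasSum_exp_apply M x y)

/-- The `m + 1` possible places of the flip in a word of length `m + 1` turn the weight `1/(m+1)!`
into `1/m!`, so nothing is lost but `κ`. -/
theorem mul_exp_apply_le_exp_add_apply {S R T : Matrix X X ℝ} {φ : X ≃ X} {κ : ℝ}
    (hφ : ∀ x, φ (φ x) = x) (hT : ∀ x y, 0 ≤ T x y) (hR : ∀ x y, 0 ≤ R x y)
    (hTS : ∀ x y, T x y ≤ S x y) (hTS' : ∀ x y, T (φ x) (φ y) ≤ S x y)
    (hκ : 0 ≤ κ) (hRκ : ∀ x, κ ≤ R x (φ x)) (x y : X) :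
    κ * NormedSpace.exp T x (φ y) ≤ NormedSpace.exp (S + R) x y := by
  have hS : ∀ x y, 0 ≤ S x y := fun x y => (hT _ _).trans (hTS x y)
  have hM : ∀ x y, 0 ≤ (S + R) x y := fun x y => add_nonneg (hS x y) (hR x y)
  have h := hasSum_exp_apply (S + R) x y
  have h' := (hasSum_nat_add_iff' 1).2 h
  have hle := hasSum_le (fun m => ?_) ((hasSum_exp_apply T x (φ y)).mul_left κ) h'
  · refine hle.trans ?_
    have h0 := pow_apply_nonneg hM 0 x y
    simp only [Finset.sum_range_one, Nat.factorial_zero, Nat.cast_one, inv_one, one_mul]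
    linarith
  · have hm := mul_pow_apply_le_pow_succ_apply hφ hT hR hTS hTS' hκ hRκ m x y
    rw [Nat.factorial_succ, Nat.cast_mul, mul_inv]
    push_cast
    calc κ * ((m.factorial : ℝ)⁻¹ * (T ^ m) x (φ y))
        = ((m + 1 : ℝ)⁻¹ * (m.factorial : ℝ)⁻¹) * (κ * (m + 1) * (T ^ m) x (φ y)) := by
          field_simp
      _ ≤ _ := mul_le_mul_of_nonneg_left hm (by positivity)

/-- If `φ` maps the complement of `G` into `G`, then `exp (S + R)` gives `G` a definite share of
the total mass of `exp T`. -/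
theorem exp_le_sum_exp_add_apply {S R T : Matrix X X ℝ} {φ : X ≃ X} {κ r : ℝ}
    (hφ : ∀ x, φ (φ x) = x) (hT : ∀ x y, 0 ≤ T x y) (hR : ∀ x y, 0 ≤ R x y)
    (hTS : ∀ x y, T x y ≤ S x y) (hTS' : ∀ x y, T (φ x) (φ y) ≤ S x y)
    (hκ : 0 ≤ κ) (hκ1 : κ ≤ 1) (hRκ : ∀ x, κ ≤ R x (φ x)) (hTr : ∀ x, ∑ y, T x y = r)
    (G : Finset X) (hG : ∀ y, y ∉ G → φ y ∈ G) (x : X) :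
    κ / 2 * Real.exp r ≤ ∑ y ∈ G, NormedSpace.exp (S + R) x y := by
  have hS : ∀ x y, 0 ≤ S x y := fun x y => (hT _ _).trans (hTS x y)
  have hM : ∀ x y, 0 ≤ (S + R) x y := fun x y => add_nonneg (hS x y) (hR x y)
  have h1 : κ * ∑ y ∈ G, NormedSpace.exp T x y ≤ ∑ y ∈ G, NormedSpace.exp (S + R) x y := by
    rw [Finset.mul_sum]
    refine Finset.sum_le_sum fun y _ => ?_
    exact (mul_le_of_le_one_left (exp_apply_nonneg hT x y) hκ1).trans
      (exp_apply_le_exp_apply hT (fun a b => (hTS a b).trans (le_add_of_nonneg_right (hR a b))) x y)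
  have h2 : κ * ∑ y ∈ Gᶜ, NormedSpace.exp T x y ≤ ∑ y ∈ G, NormedSpace.exp (S + R) x y := by
    rw [Finset.mul_sum]
    calc ∑ y ∈ Gᶜ, κ * NormedSpace.exp T x y
        ≤ ∑ y ∈ Gᶜ, NormedSpace.exp (S + R) x (φ y) := by
          refine Finset.sum_le_sum fun y _ => ?_
          have h := mul_exp_apply_le_exp_add_apply hφ hT hR hTS hTS' hκ hRκ x (φ y)
          rwa [hφ] at h
      _ = ∑ y ∈ Gᶜ.map φ.toEmbedding, NormedSpace.exp (S + R) x y := by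
          rw [Finset.sum_map]; rfl
      _ ≤ _ := by
          refine Finset.sum_le_sum_of_subset_of_nonneg ?_ fun y _ _ => exp_apply_nonneg hM x y
          intro y hy
          obtain ⟨z, hz, rfl⟩ := Finset.mem_map.1 hy
          exact hG z (Finset.mem_compl.1 hz)
  have h3 := Finset.sum_add_sum_compl G fun y => NormedSpace.exp T x y
  rw [sum_exp_apply hTr x] at h3
  -- Averaging `h1` and `h2` gives the factor `1/2`.
  rw [← h3]
  linarith

end Matrix

/-! ### Effect of a single flip on the linear form and on the kernels -/

namespace SpinChain

variable {n : ℕ}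

theorem Config.flip_flip (x : Config n) (i : Fin n) : (x.flip i).flip i = x := by
  simp [Config.flip, Config.set]

/-- Negating the spin at site `i`, as a permutation of the configurations. -/
def flipEquiv (i : Fin n) : Config n ≃ Config n where
  toFun x := x.flip i
  invFun x := x.flip i
  left_inv x := x.flip_flip i
  right_inv x := x.flip_flip i

theorem linearForm_flip (v : Fin n → ℝ) (x : Config n) (i : Fin n) :
    ∑ k, v k * (x.flip i).toReal k = ∑ k, v k * x.toReal k - 2 * (v i * x.toReal i) := by
  rw [← Finset.add_sum_erase _ _ (Finset.mem_univ i),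
    ← Finset.add_sum_erase _ (fun k => v k * x.toReal k) (Finset.mem_univ i)]
  have h : ∑ k ∈ Finset.univ.erase i, v k * (x.flip i).toReal k =
      ∑ k ∈ Finset.univ.erase i, v k * x.toReal k := by
    refine Finset.sum_congr rfl fun k hk => ?_
    simp [Config.toReal, Config.flip, Config.set, Finset.ne_of_mem_erase hk]
  have h' : (x.flip i).toReal i = -x.toReal i := by
    simp [Config.toReal, Config.flip, Config.set]
  rw [h, h']
  ring

theorem le_abs_linearForm_flip {v : Fin n → ℝ} {i : Fin n} {α c : ℝ} (hv : α ≤ |v i|)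
    {x : Config n} (hx : ¬ α ≤ |∑ k, v k * x.toReal k - c|) :
    α ≤ |∑ k, v k * (x.flip i).toReal k - c| := by
  rw [linearForm_flip]
  have h : |v i * x.toReal i| = |v i| := by
    rcases Int.units_eq_one_or (x i) with h | h <;> simp [Config.toReal, h]
  have h2 := abs_sub_abs_le_abs_sub (2 * (v i * x.toReal i)) (∑ k, v k * x.toReal k - c)
  rw [abs_mul, h, abs_two, abs_sub_comm (2 * _)] at h2
  have h3 : ∑ k, v k * x.toReal k - 2 * (v i * x.toReal i) - c =
      ∑ k, v k * x.toReal k - c - 2 * (v i * x.toReal i) := by ring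
  rw [h3]
  linarith [not_le.1 hx]

/-- `x` and `x.flip i` agree at `k` and differ only at `i`, so the exponent in `IsBounded` is the
single term `γ * |A k i|`; symmetry of `A` turns it into `γ * |A i k|`. -/
theorem IsSingleSite.exp_mul_apply_flip_le {P : Fin n → Matrix (Config n) (Config n) ℝ}
    (hP : IsSingleSite P) {A : Matrix (Fin n) (Fin n) ℝ} {γ : ℝ} (hA : A.IsSymm)
    (hb : IsBounded A P γ) {i k : Fin n} (hk : k ≠ i) (x y : Config n) :
    Real.exp (-(γ * |A i k|)) * P k (x.flip i) (y.flip i) ≤ P k x y := by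
  rw [Real.exp_neg, inv_mul_le_iff₀ (Real.exp_pos _)]
  by_cases hy : y.flip i = (x.flip i).set k (y k)
  · have hy' : y = x.set k (y k) := by
      have h := congrArg (fun z => Config.flip z i) hy
      simp only [Config.flip_flip] at h
      conv_lhs => rw [h]
      funext j
      by_cases hj : j = i
      · subst hj
        simp [Config.flip, Config.set, hk.symm]
      · by_cases hjk : j = k
        · subst hjk
          simp [Config.flip, Config.set, hj]
        · simp [Config.flip, Config.set, hj, hjk]
    have h := hb k (x.flip i) x (by simp [Config.flip, Config.set, hk]) (y k)
    rw [← hy, ← hy'] at h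
    have hf : Finset.univ.filter (fun j => x.flip i j ≠ x j) = {i} := by
      ext j
      rw [Finset.mem_filter, Finset.mem_singleton]
      by_cases hj : j = i
      · subst hj
        rcases Int.units_eq_one_or (x j) with hx | hx <;> simp [Config.flip, Config.set, hx]
      · simp [Config.flip, Config.set, hj]
    rwa [hf, Finset.sum_singleton, hA.apply] at h
  · have hz : P k (x.flip i) (y.flip i) = 0 := by
      have hyk : y.flip i k = y k := by simp [Config.flip, Config.set, hk]
      refine hP.single k _ _ (fun h => hy ?_) (fun h => hy ?_)
      · rw [← hyk, h]; simp [Config.set]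
      · rw [← hyk, h]; simp [Config.set, Config.flip]
    rw [hz]
    exact mul_nonneg (Real.exp_pos _).le (hP.nonneg _ _ _)

/-! ### Transition matrices -/

theorem transition_eq (P : Fin n → Matrix (Config n) (Config n) ℝ) (t : ℝ) :
    transition P t = Real.exp (-(t * n)) • NormedSpace.exp (t • ∑ i, P i) := by
  have h : t • generator P = Matrix.scalar (Config n) (-(t * n)) + t • ∑ i, P i := by
    rw [generator, Finset.sum_sub_distrib, Finset.sum_const, Finset.card_univ, Fintype.card_fin,
      Matrix.scalar_apply, ← Matrix.smul_one_eq_diagonal, ← Nat.cast_smul_eq_nsmul ℝ, smul_sub,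
      smul_smul, neg_smul]
    abel
  have hd : NormedSpace.exp (Matrix.scalar (Config n) (-(t * n))) =
      Matrix.scalar (Config n) (Real.exp (-(t * n))) := by
    rw [Matrix.scalar_apply, Matrix.exp_diagonal, Matrix.scalar_apply]
    congr 1
    funext x
    rw [Pi.coe_exp, Real.exp_eq_exp_ℝ]
  rw [transition, h, Matrix.exp_add_of_commute _ _ (Matrix.scalar_commute _ (Commute.all _) _), hd,
    Matrix.scalar_apply, ← Matrix.smul_one_eq_diagonal, smul_mul_assoc, one_mul]

theorem transition_add (P : Fin n → Matrix (Config n) (Config n) ℝ) (s t : ℝ) :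
    transition P (s + t) = transition P s * transition P t := by
  rw [transition, add_smul,
    Matrix.exp_add_of_commute _ _ (((Commute.refl _).smul_left s).smul_right t)]
  rfl

theorem IsSingleSite.transition_nonneg {P : Fin n → Matrix (Config n) (Config n) ℝ}
    (hP : IsSingleSite P) {t : ℝ} (ht : 0 ≤ t) (x y : Config n) : 0 ≤ transition P t x y := by
  rw [transition_eq, Matrix.smul_apply, smul_eq_mul]
  refine mul_nonneg (Real.exp_pos _).le (Matrix.exp_apply_nonneg (fun a b => ?_) x y)
  rw [Matrix.smul_apply, Matrix.sum_apply]
  exact mul_nonneg ht (Finset.sum_nonneg fun i _ => hP.nonneg i a b)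

theorem IsSingleSite.sum_transition {P : Fin n → Matrix (Config n) (Config n) ℝ}
    (hP : IsSingleSite P) (t : ℝ) (x : Config n) : ∑ y, transition P t x y = 1 := by
  have h : ∀ x, ∑ y, (t • generator P) x y = 0 := fun x => by
    simp_rw [generator, Matrix.smul_apply, Matrix.sum_apply, Matrix.sub_apply, smul_eq_mul,
      ← Finset.mul_sum]
    rw [Finset.sum_comm]
    simp [hP.row_sum, Matrix.one_apply]
  rw [transition, Matrix.sum_exp_apply h, Real.exp_zero]

/-- Anti-concentration after unit time, for a set `G` that contains `x` or `x.flip i` for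
every `x`. -/
theorem IsSingleSite.le_sum_transition_one {P : Fin n → Matrix (Config n) (Config n) ℝ}
    (hP : IsSingleSite P) {A : Matrix (Fin n) (Fin n) ℝ} {h : Fin n → ℝ} {d : ℕ} {lam α₀ γ κ : ℝ}
    (hA : IsingAssumption A h d lam α₀) (hb : IsBounded A P γ) (hγ : 0 ≤ γ) (hκ : 0 ≤ κ)
    (hflip : ∀ i x, κ ≤ P i x (x.flip i)) (i : Fin n) (G : Finset (Config n))
    (hG : ∀ y, y ∉ G → y.flip i ∈ G) (x : Config n) :
    κ / 2 * Real.exp (-1 - γ * lam) ≤ ∑ y ∈ G, transition P 1 x y := by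
  classical
  set T : Matrix (Config n) (Config n) ℝ :=
    ∑ k ∈ Finset.univ.erase i, Real.exp (-(γ * |A i k|)) • P k with hTdef
  set r : ℝ := ∑ k ∈ Finset.univ.erase i, Real.exp (-(γ * |A i k|)) with hr
  have hκ1 : κ ≤ 1 := (hflip i x).trans <| by
    rw [← hP.row_sum i x]
    exact Finset.single_le_sum (fun y _ => hP.nonneg i x y) (Finset.mem_univ _)
  have hTapp (a b : Config n) :
      T a b = ∑ k ∈ Finset.univ.erase i, Real.exp (-(γ * |A i k|)) * P k a b := by
    simp [hTdef, Matrix.sum_apply]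
  have key := Matrix.exp_le_sum_exp_add_apply (S := ∑ k ∈ Finset.univ.erase i, P k) (R := P i)
    (T := T) (φ := flipEquiv i) (κ := κ) (r := r) (fun x => x.flip_flip i)
    (fun a b => by
      rw [hTapp]
      exact Finset.sum_nonneg fun k _ => mul_nonneg (Real.exp_pos _).le (hP.nonneg k a b))
    (hP.nonneg i)
    (fun a b => by
      rw [hTapp, Matrix.sum_apply]
      refine Finset.sum_le_sum fun k _ => mul_le_of_le_one_left (hP.nonneg k a b) ?_
      rw [Real.exp_le_one_iff]
      have := mul_nonneg hγ (abs_nonneg (A i k))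
      linarith)
    (fun a b => by
      rw [hTapp, Matrix.sum_apply]
      exact Finset.sum_le_sum fun k hk =>
        hP.exp_mul_apply_flip_le hA.symm hb (Finset.ne_of_mem_erase hk) a b)
    hκ hκ1 (hflip i)
    (fun a => by
      simp_rw [hTapp]
      rw [Finset.sum_comm]
      simp_rw [← Finset.mul_sum, hP.row_sum, mul_one]
      rfl)
    G hG x
  rw [Finset.sum_erase_add _ _ (Finset.mem_univ i)] at key
  -- Uses `1 - u ≤ e^{-u}` termwise, then the width bound.
  have hr' : (n : ℝ) - 1 - γ * lam ≤ r := by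
    have h1 : ∑ k ∈ Finset.univ.erase i, (1 - γ * |A i k|) ≤ r :=
      Finset.sum_le_sum fun k _ => by linarith [Real.add_one_le_exp (-(γ * |A i k|))]
    rw [Finset.sum_sub_distrib, ← Finset.mul_sum, Finset.sum_const,
      Finset.card_erase_of_mem (Finset.mem_univ i), Finset.card_univ, Fintype.card_fin,
      nsmul_eq_mul, mul_one, Nat.cast_pred i.pos] at h1
    have h2 : γ * ∑ k ∈ Finset.univ.erase i, |A i k| ≤ γ * lam :=
      mul_le_mul_of_nonneg_left (by linarith [hA.width i, abs_nonneg (h i)]) hγ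
    linarith
  simp_rw [transition_eq, one_mul, one_smul, Matrix.smul_apply, smul_eq_mul, ← Finset.mul_sum]
  calc κ / 2 * Real.exp (-1 - γ * lam)
      ≤ κ / 2 * Real.exp (-n + r) := by
        refine mul_le_mul_of_nonneg_left (Real.exp_le_exp.2 ?_) (by positivity)
        linarith
    _ = Real.exp (-n) * (κ / 2 * Real.exp r) := by rw [Real.exp_add]; ring
    _ ≤ _ := mul_le_mul_of_nonneg_left key (Real.exp_pos _).le

/-- Condition on the state at time `t - s`: a bound uniform in the starting point survives
averaging. -/
theorem IsSingleSite.le_sum_transition {P : Fin n → Matrix (Config n) (Config n) ℝ}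
    (hP : IsSingleSite P) {G : Finset (Config n)} {ε s t : ℝ}
    (hG : ∀ x, ε ≤ ∑ y ∈ G, transition P s x y) (ht : s ≤ t) (x : Config n) :
    ε ≤ ∑ y ∈ G, transition P t x y := by
  have h : t = (t - s) + s := by ring
  rw [h, transition_add]
  simp_rw [Matrix.mul_apply]
  rw [Finset.sum_comm]
  simp_rw [← Finset.mul_sum]
  calc ε = ∑ z, transition P (t - s) x z * ε := by
        rw [← Finset.sum_mul, hP.sum_transition, one_mul]
    _ ≤ _ := Finset.sum_le_sum fun z _ =>
        mul_le_mul_of_nonneg_left (hG z) (hP.transition_nonneg (sub_nonneg.2 ht) x z)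

/-! ### The law of the chain at a fixed time, and the conclusion -/

theorem IsChain.real_mem_eq {P : Fin n → Matrix (Config n) (Config n) ℝ} {D : PMF (Config n)}
    {Ω : Type*} [MeasurableSpace Ω] {ℙ : MeasureTheory.Measure Ω}
    [MeasureTheory.IsProbabilityMeasure ℙ] {X : ℝ≥0 → Ω → Config n} (hX : IsChain P D ℙ X)
    (t : ℝ≥0) (G : Finset (Config n)) :
    ℙ.real {ω | X t ω ∈ G} = ∑ x, (D x).toReal * ∑ y ∈ G, transition P t x y := by
  have hpair (x y : Config n) :
      ℙ.real {ω | X 0 ω = x ∧ X t ω = y} = (D x).toReal * transition P t x y := by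
    have h := hX.fdd 1 ![0, t] (by
      refine Fin.monotone_iff_le_succ.2 fun k => ?_
      fin_cases k
      simp) rfl ![x, y]
    simpa [Fin.forall_fin_two] using h
  have hset : {ω | X t ω ∈ G} =
      ⋃ p ∈ (Finset.univ : Finset (Config n)) ×ˢ G, {ω | X 0 ω = p.1 ∧ X t ω = p.2} := by
    ext ω
    simp
  rw [hset, MeasureTheory.measureReal_biUnion_finset, Finset.sum_product]
  · simp_rw [hpair, Finset.mul_sum]
  · intro p _ q _ hpq
    refine Set.disjoint_left.2 fun ω hp hq => hpq ?_
    exact Prod.ext (hp.1.symm.trans hq.1) (hp.2.symm.trans hq.2)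
  · exact fun p _ => (hX.measurable 0 p.1).inter (hX.measurable t p.2)

end SpinChain

theorem PMF.sum_toReal {X : Type*} [Fintype X] (D : PMF X) : ∑ x, (D x).toReal = 1 := by
  rw [← ENNReal.toReal_sum fun x _ => D.apply_ne_top x, ← tsum_fintype (L := .unconditional _),
    D.tsum_coe, ENNReal.toReal_one]

theorem mainTheorem7 :
    ∃ c' > (0 : ℝ), ∃ C > (0 : ℝ),
      ∀ (n : ℕ) (A : Matrix (Fin n) (Fin n) ℝ) (h : Fin n → ℝ)
        (d : ℕ) (lam α₀ δ₀ : ℝ) (η : ℝ → ℝ) (γ κ : ℝ)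
        (P : Fin n → Matrix (SpinChain.Config n) (SpinChain.Config n) ℝ),
        SpinChain.IsingAssumption A h d lam α₀ →
        SpinChain.ChainAssumption A h P lam α₀ δ₀ η γ κ →
        ∀ α > (0 : ℝ), ∀ (v : Fin n → ℝ) (i : Fin n), α ≤ |v i| →
        ∀ (c : ℝ) (D : PMF (SpinChain.Config n))
          {Ω : Type*} [MeasurableSpace Ω] (ℙ : MeasureTheory.Measure Ω)
          [MeasureTheory.IsProbabilityMeasure ℙ] (X : ℝ≥0 → Ω → SpinChain.Config n),
          SpinChain.IsChain P D ℙ X →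
          ∀ t : ℝ≥0, 1 ≤ t →
            c' * Real.exp (-(C * (γ * lam))) * κ ^ 4 ≤
              ℙ.real {ω | α ≤ |∑ k, v k * (X t ω).toReal k - c|} := by 
  -- The argument gives `κ/2 * e^{-1-γλ}`, linear in `κ`; since `κ ≤ 1` this dominates the version
  -- with `κ ^ 4`.
  refine ⟨Real.exp (-1) / 2, by positivity, 1, one_pos, ?_⟩
  intro n A h d lam α₀ δ₀ η γ κ P hA hP α _ v i hv c D Ω _ ℙ _ X hX t ht
  classical
  have hκ1 : κ ≤ 1 := (hP.flip_ge i 1).trans <| by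
    rw [← hP.single_site.row_sum i 1]
    exact Finset.single_le_sum (fun y _ => hP.single_site.nonneg i 1 y) (Finset.mem_univ _)
  set G : Finset (SpinChain.Config n) :=
    Finset.univ.filter fun y => α ≤ |∑ k, v k * y.toReal k - c| with hGdef
  have hG : ∀ x, κ / 2 * Real.exp (-1 - γ * lam) ≤ ∑ y ∈ G, SpinChain.transition P t x y :=
    hP.single_site.le_sum_transition
      (hP.single_site.le_sum_transition_one hA hP.bounded hP.gamma_nonneg hP.kappa_pos.le
        hP.flip_ge i G fun y hy => by
          simp only [hGdef, Finset.mem_filter, Finset.mem_univ, true_and] at hy ⊢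
          exact SpinChain.le_abs_linearForm_flip hv hy)
      (by exact_mod_cast ht)
  have hset : {ω | α ≤ |∑ k, v k * (X t ω).toReal k - c|} = {ω | X t ω ∈ G} := by
    simp [hGdef]
  rw [hset, hX.real_mem_eq]
  calc Real.exp (-1) / 2 * Real.exp (-(1 * (γ * lam))) * κ ^ 4
      ≤ Real.exp (-1) / 2 * Real.exp (-(1 * (γ * lam))) * κ :=
        mul_le_mul_of_nonneg_left (pow_le_of_le_one hP.kappa_pos.le hκ1 (by norm_num))
          (by positivity)
    _ = ∑ x, (D x).toReal * (κ / 2 * Real.exp (-1 - γ * lam)) := by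
        rw [← Finset.sum_mul, D.sum_toReal, one_mul, sub_eq_add_neg, Real.exp_add, one_mul]
        ring
    _ ≤ _ := Finset.sum_le_sum fun x _ =>
        mul_le_mul_of_nonneg_left (hG x) ENNReal.toReal_nonneg
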